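/- For $r\ge 1$ and integers $k_1\ge 2$, $k_2,\dots,k_r\ge 1$ let $$\zeta(k_1,\dots,k_r)=\sum_{m_1>\cdots>m_r>0}\frac{1}{m_1^{k_1}\cdots m_r^{k_r}}$$ be the multiple zeta value. For $d_1,\dots,d_{r-1}\ge 0$ and $d_r\ge 1$ let $$\xi(d_1,\dots,d_r)=\sum_{0<m_1<\cdots<m_r}\frac{1}{m_1\cdots m_r}\,\Omega\Bigl[\prod_{i=1}^r\Bigl(\frac1{m_i}+\cdots+\frac1{m_r}\Bigr)^{d_i}\Bigr]$$ be the conjugated multiple zeta value, where $\Omega$ is the $\mathbb{Q}$-linear endomorphism of the polynomial ring $\mathbb{Q}[m_1^{-1},\dots,m_r^{-1}]$ (the $m_i^{-1}$ being treated as independent variables) with $$\Omega\Bigl[\frac{1}{m_1^{l_1}\cdots m_r^{l_r}}\Bigr]=\frac{l_1!\cdots l_r!}{m_1^{l_1}\cdots m_r^{l_r}}.$$ Then for all integers $a,b\ge 0$ all the series $\xi$ and $\zeta$ below converge, and $$\sum_{i=0}^a\frac{(-1)^{a-i}}{i!\,(a+1-i)!}\,\xi(i,\underbrace{0,\dots,0}_{b-1},a-i+1)=\zeta(a+b+2)=\sum_{\substack{k_1+\cdots+k_{b+1}=a+b+2\\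 k_1\ge 2,\ k_2,\dots,k_{b+1}\ge 1}}\zeta(k_1,\dots,k_{b+1}).$$ Here the argument of $\xi$ is the index of length $b+1$ with first entry $i$, last entry $a-i+1$, and $b-1$ zeros in between; for $b=0$, where the first and the last position coincide, it is read as the sum of the two entries, i.e. as $\xi(a+1)$. -/

import Mathlib

open scoped Nat

noncomputable section

namespace ConjMZV

/-- The linear map `Ω` on polynomials in `r` variables (the variable `X i` stands for `1 / mᵢ`),
determined by `Ω[∏ᵢ Xᵢ ^ lᵢ] = (∏ᵢ lᵢ!) ∏ᵢ Xᵢ ^ lᵢ`. -/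
def Omega (r : ℕ) : MvPolynomial (Fin r) ℚ →ₗ[ℚ] MvPolynomial (Fin r) ℚ :=
  (MvPolynomial.basisMonomials (Fin r) ℚ).constr ℚ
    (fun l : Fin r →₀ ℕ => MvPolynomial.monomial l (∏ i, ((l i)! : ℚ)))

/-- The polynomial `∏ᵢ (Xᵢ + ⋯ + X_r) ^ dᵢ`. -/
def tailProd {r : ℕ} (d : Fin r → ℕ) : MvPolynomial (Fin r) ℚ :=
  ∏ i, (∑ j ∈ Finset.Ici i, MvPolynomial.X j) ^ d i

/-- The tuples `0 < m₁ < ⋯ < m_r`. -/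
abbrev IncTuple (r : ℕ) : Type := {m : Fin r → ℕ // StrictMono m ∧ ∀ i, 0 < m i}

/-- The tuples `m₁ > ⋯ > m_r > 0`. -/
abbrev DecTuple (r : ℕ) : Type := {m : Fin r → ℕ // StrictAnti m ∧ ∀ i, 0 < m i}

/-- The summand of `ξ(d₁, …, d_r)`:
`1 / (m₁ ⋯ m_r) * Ω[∏ᵢ (1 / mᵢ + ⋯ + 1 / m_r) ^ dᵢ]`. -/
def xiTerm {r : ℕ} (d : Fin r → ℕ) (m : IncTuple r) : ℝ :=
  (∏ i, (1 : ℝ) / (m.1 i : ℝ)) *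
    MvPolynomial.aeval (fun i => (1 : ℝ) / (m.1 i : ℝ)) (Omega r (tailProd d))

/-- The conjugated multiple zeta value `ξ(d₁, …, d_r)`, a convergent series if `d_r ≥ 1`. -/
def xi {r : ℕ} (d : Fin r → ℕ) : ℝ := ∑' m : IncTuple r, xiTerm d m

/-- The summand `1 / (m₁ ^ k₁ ⋯ m_r ^ k_r)` of `ζ(k₁, …, k_r)`. -/
def mzvTerm {r : ℕ} (k : Fin r → ℕ) (m : DecTuple r) : ℝ :=
  ∏ i, (1 : ℝ) / (m.1 i : ℝ) ^ k i

/-- The multiple zeta value `ζ(k₁, …, k_r)`, a convergent series if `k₁ ≥ 2` and all `kᵢ ≥ 1`. -/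
def mzv {r : ℕ} (k : Fin r → ℕ) : ℝ := ∑' m : DecTuple r, mzvTerm k m

/-- The index `(i, 0, …, 0, c)` of length `b + 1`, with `b - 1` zeros, for `b ≥ 1`. For `b = 0`
the first and the last position coincide and their entries add up: the index is `(i + c)`. -/
def endsIndex (b i c : ℕ) : Fin (b + 1) → ℕ := Pi.single 0 i + Pi.single (Fin.last b) c

/-- The admissible indices `(k₁, …, k_{b+1})` of weight `w`: `k₁ + ⋯ + k_{b+1} = w`, `k₁ ≥ 2`,
and all `kⱼ ≥ 1`. -/
def admissibleIndices (b w : ℕ) : Finset (Fin (b + 1) → ℕ) :=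
  (Finset.Nat.antidiagonalTuple (b + 1) w).filter (fun k => 2 ≤ k 0 ∧ ∀ j, 1 ≤ k j)

end ConjMZV

end

namespace ConjMZV

open Finset Filter Topology

/-! The left equality holds summand by summand. By the binomial theorem the combination of the
products `S ^ i * x ^ (a - i + 1)`, where `S` is the sum of all variables and `x` the last one, is
`(S ^ (a + 1) - (S - x) ^ (a + 1)) / (a + 1)!`. `Ω` turns it into the difference of two complete
homogeneous polynomials: all monomials of degree `a + 1` containing `x`. The prefactor raises every
exponent by one, so reversing the tuple gives exactly the admissible indices
(`sum_smul_Omega_tailProd`, `sum_lastPosExponents`).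

What remains is the sum formula, proved by connected sums. The symmetric connector `C(m, n)`
satisfies `∑_{k > m} C(k, n) / (k - t) = C(m, n) / n`. Summing out a decreasing tuple against it
gives `1 / n ^ r`; inserting this into `∑ 1 / (n ^ (b + 1) (n - t))` and summing over `n` first
gives the generating function of the multiple zeta values. Coefficients in `t` are compared in
`ℝ≥0∞`, where interchanges are free and convergence is a by-product. -/

/-- The shifted factorial `(1 - t)(2 - t)⋯(m - t)`. -/
def shiftedFactorial (t : ℝ) (m : ℕ) : ℝ := ∏ i ∈ range m, ((i : ℝ) + 1 - t)

/-- The connector of the Seki–Yamamoto connected sum method. -/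
noncomputable def connector (t : ℝ) (m n : ℕ) : ℝ :=
  shiftedFactorial t m * shiftedFactorial t n / shiftedFactorial t (m + n)

/-! ### Telescoping of the connector -/

section Connector

variable {t : ℝ}

lemma shiftedFactorial_succ (t : ℝ) (m : ℕ) :
    shiftedFactorial t (m + 1) = shiftedFactorial t m * ((m : ℝ) + 1 - t) :=
  prod_range_succ _ _

lemma shiftedFactorial_pos (ht : t < 1) (m : ℕ) : 0 < shiftedFactorial t m :=
  prod_pos fun i _ => by have : (0 : ℝ) ≤ i := i.cast_nonneg; linarith

lemma connector_pos (ht : t < 1) (m n : ℕ) : 0 < connector t m n :=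
  div_pos (mul_pos (shiftedFactorial_pos ht _) (shiftedFactorial_pos ht _))
    (shiftedFactorial_pos ht _)

lemma connector_comm (t : ℝ) (m n : ℕ) : connector t m n = connector t n m := by
  rw [connector, connector, add_comm m n, mul_comm (shiftedFactorial t m)]

lemma connector_zero_left (ht : t < 1) (n : ℕ) : connector t 0 n = 1 := by
  have h0 : shiftedFactorial t 0 = 1 := prod_range_zero _
  rw [connector, h0, zero_add, one_mul, div_self (shiftedFactorial_pos ht n).ne']

lemma connector_succ (ht : t < 1) (m n : ℕ) :
    connector t (m + 1) n = connector t m n * ((m + 1 - t) / (m + n + 1 - t)) := by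
  have h1 := (shiftedFactorial_pos ht (m + n)).ne'
  have h2 : ((m : ℝ) + n + 1 - t) ≠ 0 := by
    have hm : (0 : ℝ) ≤ m := m.cast_nonneg
    have hn : (0 : ℝ) ≤ n := n.cast_nonneg
    linarith
  rw [connector, connector, add_right_comm, shiftedFactorial_succ, shiftedFactorial_succ]
  push_cast
  field_simp

/-- The quotient of the two connectors is `(m + n + 1 - t) / (m + 1 - t)`, which exceeds `1` by `n /
(m + 1 - t)`. -/
lemma connector_sub_succ (ht : t < 1) (m n : ℕ) :
    connector t m n - connector t (m + 1) n =
      n * (1 / ((m : ℝ) + 1 - t) * connector t (m + 1) n) := by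
  have hm : (0 : ℝ) ≤ m := m.cast_nonneg
  have hn : (0 : ℝ) ≤ n := n.cast_nonneg
  have h1 : ((m : ℝ) + 1 - t) ≠ 0 := by linarith
  have h2 : ((m : ℝ) + n + 1 - t) ≠ 0 := by linarith
  rw [connector_succ ht]
  field_simp
  ring

lemma connector_le_one (ht : t < 1) (m n : ℕ) : connector t m n ≤ 1 := by
  induction m with
  | zero => exact (connector_zero_left ht n).le
  | succ m ih =>
    have hm : (0 : ℝ) ≤ m := m.cast_nonneg
    have h := connector_sub_succ ht m n
    have h1 : 0 ≤ (n : ℝ) * (1 / ((m : ℝ) + 1 - t) * connector t (m + 1) n) :=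
      mul_nonneg n.cast_nonneg (mul_nonneg (one_div_nonneg.2 (by linarith))
        (connector_pos ht _ _).le)
    linarith

lemma tendsto_connector (ht : t < 1) {n : ℕ} (hn : 0 < n) :
    Tendsto (fun m => connector t m n) atTop (𝓝 0) := by
  obtain ⟨n, rfl⟩ := Nat.exists_eq_succ_of_ne_zero hn.ne'
  have hlim : Tendsto (fun m : ℕ => ((n : ℝ) + 1 - t) / ((m : ℝ) + (n + 1 - t))) atTop (𝓝 0) :=
    tendsto_const_nhds.div_atTop
      (tendsto_atTop_add_const_right _ _ tendsto_natCast_atTop_atTop)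
  refine squeeze_zero (fun m => (connector_pos ht _ _).le) (fun m => ?_) hlim
  have hm : (0 : ℝ) ≤ m := m.cast_nonneg
  have hn : (0 : ℝ) ≤ n := n.cast_nonneg
  -- By symmetry one factor is split off from the second argument, which is where positivity of `n`
  -- enters; it alone tends to `0`.
  rw [connector_comm, Nat.succ_eq_add_one, connector_succ ht]
  refine (mul_le_of_le_one_left (div_nonneg (by linarith) (by linarith))
    (connector_le_one ht _ _)).trans_eq ?_
  congr 1
  ring

lemma hasSum_connector (ht : t < 1) (m : ℕ) {n : ℕ} (hn : 0 < n) :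
    HasSum (fun k : ℕ => 1 / (((m + k + 1 : ℕ) : ℝ) - t) * connector t (m + k + 1) n)
      (connector t m n / n) := by
  have hn' : (n : ℝ) ≠ 0 := by positivity
  have hterm : ∀ k : ℕ, 1 / (((m + k + 1 : ℕ) : ℝ) - t) * connector t (m + k + 1) n =
      (connector t (m + k) n - connector t (m + (k + 1)) n) / n := fun k => by
    rw [← add_assoc, connector_sub_succ ht, mul_div_cancel_left₀ _ hn']
    push_cast
    rfl
  rw [hasSum_iff_tendsto_nat_of_nonneg]
  · simp_rw [hterm, ← sum_div, sum_range_sub' (fun k => connector t (m + k) n)]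
    have := (tendsto_connector ht hn).comp (tendsto_add_atTop_nat m)
    simpa [Function.comp_def, add_comm] using (this.const_sub (connector t m n)).div_const (n : ℝ)
  · intro k
    have hm : (0 : ℝ) ≤ m := m.cast_nonneg
    have hk : (0 : ℝ) ≤ k := k.cast_nonneg
    exact mul_nonneg (one_div_nonneg.2 (by push_cast; linarith)) (connector_pos ht _ _).le

lemma tsum_ofReal_connector (ht : t < 1) (m : ℕ) {n : ℕ} (hn : 0 < n) :
    ∑' k : ℕ, ENNReal.ofReal (1 / (((m + k + 1 : ℕ) : ℝ) - t) * connector t (m + k + 1) n) =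
      ENNReal.ofReal (connector t m n / n) := by
  rw [← (hasSum_connector ht m hn).tsum_eq, ENNReal.ofReal_tsum_of_nonneg _
    (hasSum_connector ht m hn).summable]
  intro k
  have hm : (0 : ℝ) ≤ m := m.cast_nonneg
  have hk : (0 : ℝ) ≤ k := k.cast_nonneg
  exact mul_nonneg (one_div_nonneg.2 (by push_cast; linarith)) (connector_pos ht _ _).le

end Connector

/-! ### Connected sums over decreasing tuples -/

/-- The first entry of a tuple, read as `0` for the empty tuple. -/
def headOrZero : ∀ {r : ℕ}, (Fin r → ℕ) → ℕ
  | 0, _ => 0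
  | _ + 1, m => m 0

/-- A decreasing tuple of length `r + 1` is a decreasing tuple of length `r` together with the
excess of its first entry over the second one. -/
def DecTuple.consEquiv (r : ℕ) : DecTuple r × ℕ ≃ DecTuple (r + 1) where
  toFun p := ⟨Fin.cons (headOrZero p.1.1 + p.2 + 1) p.1.1, by
    obtain ⟨⟨m, hm, hpos⟩, k⟩ := p
    refine ⟨?_, fun i => Fin.cases (Nat.succ_pos _) (fun j => by simpa using hpos j) i⟩
    rw [Fin.strictAnti_iff_succ_lt]
    cases r with
    | zero => exact fun i => i.elim0
    | succ r =>
      intro i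
      refine Fin.cases ?_ (fun j => ?_) i
      · simp [headOrZero]
      · rw [Fin.cons_succ, ← Fin.succ_castSucc, Fin.cons_succ]
        exact hm Fin.castSucc_lt_succ⟩
  invFun m := ⟨⟨Fin.tail m.1, fun i j h => m.2.1 (Fin.succ_lt_succ_iff.2 h), fun i => m.2.2 _⟩,
    m.1 0 - headOrZero (Fin.tail m.1) - 1⟩
  left_inv p := by
    ext <;> simp
    omega
  right_inv m := by
    obtain ⟨m, hm, hpos⟩ := m
    have h : headOrZero (Fin.tail m) < m 0 := by
      cases r with
      | zero => exact hpos 0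
      | succ r => exact hm (Fin.succ_pos 0)
    apply Subtype.ext
    change (Fin.cons (headOrZero (Fin.tail m) + (m 0 - headOrZero (Fin.tail m) - 1) + 1)
      (Fin.tail m) : Fin (r + 1) → ℕ) = m
    rw [show headOrZero (Fin.tail m) + (m 0 - headOrZero (Fin.tail m) - 1) + 1 = m 0 by omega,
      Fin.cons_self_tail]

lemma tsum_decTuple_succ {r : ℕ} (f : (Fin (r + 1) → ℕ) → ENNReal) :
    ∑' m : DecTuple (r + 1), f m.1 =
      ∑' (m : DecTuple r) (k : ℕ), f (Fin.cons (headOrZero m.1 + k + 1) m.1) := by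
  rw [← (DecTuple.consEquiv r).tsum_eq, ← ENNReal.tsum_prod]
  rfl

instance : Unique (DecTuple 0) where
  default := ⟨Fin.elim0, fun i => i.elim0, fun i => i.elim0⟩
  uniq _ := Subtype.ext (Subsingleton.elim _ _)

lemma one_div_sub_pos {t : ℝ} (ht : t < 1) {n : ℕ} (hn : 0 < n) : 0 < 1 / ((n : ℝ) - t) := by
  have : (1 : ℝ) ≤ n := by exact_mod_cast hn
  exact one_div_pos.2 (by linarith)

lemma prod_one_div_sub_pos {t : ℝ} (ht : t < 1) {r : ℕ} (m : DecTuple r) :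
    0 < ∏ i, 1 / ((m.1 i : ℝ) - t) :=
  prod_pos fun i _ => one_div_sub_pos ht (m.2.2 i)

/-- Summing out the largest entry telescopes: it shortens the tuple by one and costs a factor `1 /
n`. The empty tuple contributes `C(0, n) = 1`. -/
lemma tsum_prod_mul_connector {t : ℝ} (ht : t < 1) {n : ℕ} (hn : 0 < n) (r : ℕ) :
    ∑' m : DecTuple r,
        ENNReal.ofReal ((∏ i, 1 / ((m.1 i : ℝ) - t)) * connector t (headOrZero m.1) n) =
      ENNReal.ofReal (1 / (n : ℝ) ^ r) := by
  induction r with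
  | zero =>
    rw [tsum_fintype, Fintype.sum_unique]
    simp [headOrZero, connector_zero_left ht]
  | succ r ih =>
    rw [tsum_decTuple_succ fun m => ENNReal.ofReal
      ((∏ i, 1 / ((m i : ℝ) - t)) * connector t (headOrZero m) n)]
    have key : ∀ m : DecTuple r, ∑' k : ℕ, ENNReal.ofReal
        ((∏ i, 1 / (((Fin.cons (headOrZero m.1 + k + 1) m.1 : Fin (r + 1) → ℕ) i : ℝ) - t)) *
          connector t (headOrZero (Fin.cons (headOrZero m.1 + k + 1) m.1 : Fin (r + 1) → ℕ)) n) =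
        ENNReal.ofReal (1 / n) * ENNReal.ofReal
          ((∏ i, 1 / ((m.1 i : ℝ) - t)) * connector t (headOrZero m.1) n) := fun m => by
      have hw := (prod_one_div_sub_pos ht m).le
      calc _ = ∑' k : ℕ, ENNReal.ofReal (∏ i, 1 / ((m.1 i : ℝ) - t)) * ENNReal.ofReal
              (1 / (((headOrZero m.1 + k + 1 : ℕ) : ℝ) - t) *
                connector t (headOrZero m.1 + k + 1) n) := by
            refine tsum_congr fun k => ?_
            rw [← ENNReal.ofReal_mul hw, Fin.prod_univ_succ]
            simp only [Fin.cons_zero, Fin.cons_succ, headOrZero]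
            congr 1
            ring
        _ = _ := by
            rw [ENNReal.tsum_mul_left, tsum_ofReal_connector ht _ hn, ← ENNReal.ofReal_mul hw,
              ← ENNReal.ofReal_mul (by positivity)]
            congr 1
            ring
    simp_rw [key]
    rw [ENNReal.tsum_mul_left, ih, ← ENNReal.ofReal_mul (by positivity)]
    congr 1
    rw [pow_succ']
    field_simp

/-- The sum formula for multiple zeta values in the form of generating functions. -/
lemma tsum_prod_one_div_sub {t : ℝ} (ht : t < 1) (b : ℕ) :
    ∑' m : DecTuple (b + 1),
        ENNReal.ofReal ((∏ i, 1 / ((m.1 i : ℝ) - t)) * (1 / (m.1 0 : ℝ))) =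
      ∑' n : ℕ, ENNReal.ofReal (1 / ((n + 1 : ℕ) : ℝ) ^ (b + 1) * (1 / (((n + 1 : ℕ) : ℝ) - t))) := by
  have hR : ∀ n : ℕ, ENNReal.ofReal
      (1 / ((n + 1 : ℕ) : ℝ) ^ (b + 1) * (1 / (((n + 1 : ℕ) : ℝ) - t))) =
      ∑' m : DecTuple (b + 1), ENNReal.ofReal (∏ i, 1 / ((m.1 i : ℝ) - t)) *
        ENNReal.ofReal (1 / (((0 + n + 1 : ℕ) : ℝ) - t) * connector t (0 + n + 1) (m.1 0)) := by
    intro n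
    rw [ENNReal.ofReal_mul (by positivity), ← tsum_prod_mul_connector ht n.succ_pos,
      ← ENNReal.tsum_mul_right]
    refine tsum_congr fun m => ?_
    have hw := (prod_one_div_sub_pos ht m).le
    rw [← ENNReal.ofReal_mul hw, ← ENNReal.ofReal_mul (mul_nonneg hw (connector_pos ht _ _).le),
      connector_comm, zero_add, headOrZero]
    congr 1
    ring
  simp_rw [hR]
  -- Now `n` is the summed variable and `m 0` the parameter; telescoping from `0` leaves `C(0, m 0)
  -- / m 0 = 1 / m 0`.
  rw [ENNReal.tsum_comm]
  refine tsum_congr fun m => ?_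
  rw [ENNReal.tsum_mul_left, tsum_ofReal_connector ht 0 (m.2.2 0), connector_zero_left ht,
    ← ENNReal.ofReal_mul (prod_one_div_sub_pos ht m).le]

/-! ### The map `Ω` and complete homogeneous polynomials -/

open MvPolynomial

lemma Omega_monomial {r : ℕ} (l : Fin r →₀ ℕ) (c : ℚ) :
    Omega r (monomial l c) = monomial l (c * ∏ i, ((l i)! : ℚ)) := by
  have h : Omega r (monomial l 1) = monomial l (∏ i, ((l i)! : ℚ)) := by
    have := (basisMonomials (Fin r) ℚ).constr_basis ℚ
      (fun l : Fin r →₀ ℕ => monomial l (∏ i, ((l i)! : ℚ))) l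
    rwa [coe_basisMonomials] at this
  rw [← mul_one c, ← smul_eq_mul, ← smul_monomial, map_smul, h, smul_monomial]
  simp

lemma prod_X_pow_eq_monomial {r : ℕ} (s : Finset (Fin r)) {k : Fin r → ℕ}
    (hk : ∀ i, k i ≠ 0 → i ∈ s) :
    ∏ i ∈ s, (X i : MvPolynomial (Fin r) ℚ) ^ k i =
      monomial (Finsupp.equivFunOnFinite.symm k) 1 := by
  rw [monomial_eq, C_1, one_mul, Finsupp.prod_fintype _ _ (by simp)]
  refine prod_subset (subset_univ s) fun i _ hi => ?_
  rw [not_not.1 fun h => hi (hk i h), pow_zero]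

/-- `Ω` maps `(∑ i ∈ s, X i) ^ n / n!` to the complete homogeneous polynomial of degree `n`. -/
lemma Omega_sum_X_pow {r : ℕ} (s : Finset (Fin r)) (n : ℕ) :
    Omega r ((∑ i ∈ s, X i) ^ n) =
      ∑ k ∈ s.piAntidiag n, monomial (Finsupp.equivFunOnFinite.symm k) (n ! : ℚ) := by
  rw [sum_pow_eq_sum_piAntidiag, map_sum]
  refine sum_congr rfl fun k hk => ?_
  rw [mem_piAntidiag] at hk
  rw [prod_X_pow_eq_monomial s hk.2, ← C_eq_coe_nat, C_mul_monomial, mul_one, Omega_monomial]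
  congr 1
  -- The factorials produced by `Ω` cancel the denominator of the multinomial coefficient.
  rw [← hk.1, ← Nat.multinomial_spec s k]
  push_cast
  rw [mul_comm]
  congr 1
  refine (prod_subset (subset_univ s) fun i _ hi => ?_).symm
  simp [not_not.1 fun h => hi (hk.2 i h)]

lemma tailProd_endsIndex (b i c : ℕ) :
    tailProd (endsIndex b i c) = (∑ j, X j) ^ i * X (Fin.last b) ^ c := by
  have h0 : Ici (0 : Fin (b + 1)) = univ := by ext j; simp
  have hl : Ici (Fin.last b) = {Fin.last b} := by ext j; simp [Fin.last_le_iff]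
  -- Splitting the exponents additively also covers `b = 0`, where both ends are the same variable.
  simp only [tailProd, endsIndex, Pi.add_apply, pow_add, prod_mul_distrib]
  rw [prod_eq_single (0 : Fin (b + 1)) (fun j _ hj => by simp [hj]) (by simp),
    prod_eq_single (Fin.last b) (fun j _ hj => by simp [hj]) (by simp)]
  simp [h0, hl]

/-- The binomial theorem for `S ^ (a + 1) - (S - x) ^ (a + 1)`. -/
lemma sum_neg_one_pow_div_factorial {A : Type*} [CommRing A] [Algebra ℚ A] (a : ℕ) (S x : A) :
    ∑ i ∈ range (a + 1), ((-1 : ℚ) ^ (a - i) / ((i ! : ℚ) * ((a + 1 - i)! : ℚ))) •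
        (S ^ i * x ^ (a - i + 1)) =
      (1 / ((a + 1)! : ℚ)) • (S ^ (a + 1) - (S - x) ^ (a + 1)) := by
  -- The top term of the expansion is `S ^ (a + 1)` and cancels.
  rw [sub_eq_add_neg S x, add_pow, sum_range_succ _ (a + 1)]
  simp only [Nat.sub_self, pow_zero, mul_one, Nat.choose_self, Nat.cast_one]
  rw [sub_add_cancel_right, ← sum_neg_distrib, smul_sum]
  refine sum_congr rfl fun i hi => ?_
  have hi' : i ≤ a := by simpa [Nat.lt_succ_iff] using hi
  have hc : (((a + 1).choose i : ℕ) : A) = algebraMap ℚ A ((a + 1).choose i : ℚ) := by simp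
  rw [neg_pow x, hc, Nat.cast_choose ℚ (by omega), Algebra.smul_def, Algebra.smul_def,
    Nat.sub_add_comm hi', pow_succ (-1 : A)]
  have hn : ((-1 : A)) ^ (a - i) = algebraMap ℚ A ((-1) ^ (a - i)) := by simp
  have hf : ((a + 1)! : ℚ) ≠ 0 := by positivity
  have : algebraMap ℚ A ((-1 : ℚ) ^ (a - i) / ((i ! : ℚ) * ((a - i + 1)! : ℚ))) =
      algebraMap ℚ A (1 / ((a + 1)! : ℚ)) * (algebraMap ℚ A ((-1) ^ (a - i)) *
        algebraMap ℚ A ((a + 1)! / ((i ! : ℚ) * ((a - i + 1)! : ℚ)))) := by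
    rw [← map_mul, ← map_mul]
    congr 1
    field_simp
  rw [this, hn]
  ring

/-- The exponents of degree `a + 1` with a positive last entry. -/
def lastPosExponents (a b : ℕ) : Finset (Fin (b + 1) → ℕ) :=
  (univ.piAntidiag (a + 1)).filter fun k => k (Fin.last b) ≠ 0

lemma sum_smul_Omega_tailProd (a b : ℕ) :
    ∑ i ∈ range (a + 1), ((-1 : ℚ) ^ (a - i) / ((i ! : ℚ) * ((a + 1 - i)! : ℚ))) •
        Omega (b + 1) (tailProd (endsIndex b i (a - i + 1))) =
      ∑ k ∈ lastPosExponents a b, monomial (Finsupp.equivFunOnFinite.symm k) 1 := by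
  simp_rw [← map_smul, ← map_sum, tailProd_endsIndex]
  have hS : (∑ j, X j : MvPolynomial (Fin (b + 1)) ℚ) - X (Fin.last b) =
      ∑ j ∈ univ.erase (Fin.last b), X j := by
    rw [sub_eq_iff_eq_add, sum_erase_add _ _ (mem_univ _)]
  have hsub : (univ.erase (Fin.last b)).piAntidiag (a + 1) =
      (univ.piAntidiag (a + 1)).filter fun k => ¬ k (Fin.last b) ≠ 0 := by
    ext k
    simp only [mem_piAntidiag, mem_filter, mem_erase, mem_univ, and_true, implies_true, not_not]
    constructor
    · rintro ⟨h1, h2⟩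
      have h0 : k (Fin.last b) = 0 := not_not.1 fun h => h2 _ h rfl
      refine ⟨?_, h0⟩
      rw [← h1, ← sum_erase_add univ k (mem_univ (Fin.last b)), h0, add_zero]
    · rintro ⟨h1, h0⟩
      refine ⟨?_, fun i hi h => hi (h ▸ h0)⟩
      rw [← h1, ← sum_erase_add univ k (mem_univ (Fin.last b)), h0, add_zero]
  rw [sum_neg_one_pow_div_factorial, hS, map_smul, map_sub, Omega_sum_X_pow, Omega_sum_X_pow, hsub,
    ← sum_filter_add_sum_filter_not (univ.piAntidiag (a + 1))
      (fun k : Fin (b + 1) → ℕ => k (Fin.last b) ≠ 0), add_sub_cancel_right, smul_sum]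
  refine sum_congr rfl fun k _ => ?_
  rw [smul_monomial, smul_eq_mul, one_div_mul_cancel (by positivity)]

/-- Reversal of tuples. -/
def revEquiv (r : ℕ) : IncTuple r ≃ DecTuple r where
  toFun m := ⟨m.1 ∘ Fin.rev, fun _ _ h => m.2.1 (Fin.rev_lt_rev.2 h), fun _ => m.2.2 _⟩
  invFun m := ⟨m.1 ∘ Fin.rev, fun _ _ h => m.2.1 (Fin.rev_lt_rev.2 h), fun _ => m.2.2 _⟩
  left_inv m := by ext; simp
  right_inv m := by ext; simp

lemma prod_mul_aeval_monomial {r : ℕ} (l : Fin r →₀ ℕ) (c : ℚ) (m : IncTuple r) :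
    (∏ i, (1 : ℝ) / (m.1 i : ℝ)) *
        aeval (fun i => (1 : ℝ) / (m.1 i : ℝ)) (monomial l c) =
      c * mzvTerm (fun j => l j.rev + 1) (revEquiv r m) := by
  rw [aeval_monomial, Finsupp.prod_fintype _ _ (by simp), mul_left_comm, ← prod_mul_distrib,
    mzvTerm, ← Equiv.prod_comp Fin.revPerm]
  simp [revEquiv, pow_succ, mul_comm]

/-! ### Power series with coefficients in `ℝ≥0∞` -/

open scoped ENNReal

lemma prod_tsum_eq_tsum_prod {r : ℕ} (f : Fin r → ℕ → ℝ≥0∞) :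
    ∏ i, ∑' k, f i k = ∑' e : Fin r → ℕ, ∏ i, f i (e i) := by
  induction r with
  | zero => simp
  | succ r ih =>
    rw [Fin.prod_univ_succ, ih, ← (Fin.consEquiv fun _ => ℕ).tsum_eq, ← ENNReal.tsum_mul_right,
      ENNReal.tsum_prod']
    refine tsum_congr fun k => ?_
    rw [← ENNReal.tsum_mul_left]
    refine tsum_congr fun e => ?_
    simp [Fin.prod_univ_succ, Fin.consEquiv]

lemma coeff_zero_le_of_tsum_pow_mul_eq {A B : ℕ → ℝ≥0∞} (hB : ∑' a, 2⁻¹ ^ a * B a ≠ ∞)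
    (h : ∀ x : ℝ≥0∞, x ≠ 0 → x ≤ 2⁻¹ → ∑' a, x ^ a * A a = ∑' a, x ^ a * B a) : A 0 ≤ B 0 := by
  have hK : ∑' a, 2⁻¹ ^ a * B (a + 1) ≠ ∞ := fun hK => hB <| by
    rw [tsum_eq_zero_add' ENNReal.summable]
    simp_rw [pow_succ', mul_assoc]
    rw [ENNReal.tsum_mul_left, hK, ENNReal.mul_top (by simp), add_top]
  set K := ∑' a, 2⁻¹ ^ a * B (a + 1)
  refine ENNReal.le_of_forall_pos_le_add fun ε hε _ => ?_
  -- Small enough that the tail `x * K` is at most `ε`, and nonzero because `K` is finite.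
  set x : ℝ≥0∞ := min 2⁻¹ (ε / K)
  have hx : x ≠ 0 := by
    simp only [x, ne_eq, min_eq_iff, ENNReal.div_eq_zero_iff]
    simp [hε.ne', hK]
  have hx2 : x ≤ 2⁻¹ := min_le_left _ _
  calc A 0 = x ^ 0 * A 0 := by simp
    _ ≤ ∑' a, x ^ a * A a := ENNReal.le_tsum 0
    _ = B 0 + x * ∑' a, x ^ a * B (a + 1) := by
      rw [h x hx hx2, tsum_eq_zero_add' ENNReal.summable, ← ENNReal.tsum_mul_left]
      simp [pow_succ', mul_assoc]
    _ ≤ B 0 + x * K := by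
      gcongr
      exact ENNReal.tsum_le_tsum fun a => by gcongr
    _ ≤ B 0 + ε := by
      gcongr
      exact ENNReal.mul_le_of_le_div (min_le_right _ _)

/-- Compare constant terms as `x → 0`, subtract them, cancel `x` and induct; cancelling is why only
`x ≠ 0` is assumed. -/
lemma eq_of_tsum_pow_mul_eq {A B : ℕ → ℝ≥0∞} (hB : ∑' a, 2⁻¹ ^ a * B a ≠ ∞)
    (h : ∀ x : ℝ≥0∞, x ≠ 0 → x ≤ 2⁻¹ → ∑' a, x ^ a * A a = ∑' a, x ^ a * B a) (n : ℕ) :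
    A n = B n ∧ B n ≠ ∞ := by
  induction n generalizing A B with
  | zero =>
    have hA : ∑' a, 2⁻¹ ^ a * A a ≠ ∞ := by rwa [h 2⁻¹ (by simp) le_rfl]
    exact ⟨le_antisymm (coeff_zero_le_of_tsum_pow_mul_eq hB h)
      (coeff_zero_le_of_tsum_pow_mul_eq hA fun x hx hx2 => (h x hx hx2).symm),
      by simpa using ENNReal.ne_top_of_tsum_ne_top hB 0⟩
  | succ n ih =>
    have hA : ∑' a, 2⁻¹ ^ a * A a ≠ ∞ := by rwa [h 2⁻¹ (by simp) le_rfl]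
    have h0 : A 0 = B 0 := le_antisymm (coeff_zero_le_of_tsum_pow_mul_eq hB h)
      (coeff_zero_le_of_tsum_pow_mul_eq hA fun x hx hx2 => (h x hx hx2).symm)
    have hB0 : B 0 ≠ ∞ := by simpa using ENNReal.ne_top_of_tsum_ne_top hB 0
    have hsplit : ∀ (x : ℝ≥0∞) (F : ℕ → ℝ≥0∞),
        ∑' a, x ^ a * F a = F 0 + x * ∑' a, x ^ a * F (a + 1) := fun x F => by
      rw [tsum_eq_zero_add' ENNReal.summable, ← ENNReal.tsum_mul_left]
      simp [pow_succ', mul_assoc]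
    refine @ih (fun a => A (a + 1)) (fun a => B (a + 1)) (fun hK => hB ?_) fun x hx hx2 => ?_
    · rw [hsplit, hK, ENNReal.mul_top (by simp), add_top]
    · have hxt : x ≠ ∞ := (hx2.trans_lt (by simp)).ne
      have := h x hx hx2
      rw [hsplit, hsplit x B, h0, ENNReal.add_right_inj hB0] at this
      exact (ENNReal.mul_right_inj hx hxt).1 this

lemma hasSum_one_div_sub {t : ℝ} (h0 : 0 ≤ t) (h1 : t < 1) {n : ℕ} (hn : 0 < n) :
    HasSum (fun k : ℕ => t ^ k * (1 / (n : ℝ) ^ (k + 1))) (1 / ((n : ℝ) - t)) := by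
  have hn1 : (1 : ℝ) ≤ n := by exact_mod_cast hn
  have h := (hasSum_geometric_of_lt_one (r := t / n) (by positivity)
    ((div_lt_one (by linarith)).2 (by linarith))).mul_left (1 / (n : ℝ))
  have hf : (fun k : ℕ => t ^ k * (1 / (n : ℝ) ^ (k + 1))) = fun k => 1 / (n : ℝ) * (t / n) ^ k := by
    ext k
    rw [div_pow, pow_succ]
    field_simp
  have hv : 1 / ((n : ℝ) - t) = 1 / (n : ℝ) * (1 - t / n)⁻¹ := by
    rw [one_sub_div (by positivity), inv_div, div_mul_div_comm, one_mul, div_mul_eq_div_div,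
      div_self (by positivity)]
  rwa [hf, hv]

lemma ofReal_one_div_sub {t : ℝ} (h0 : 0 ≤ t) (h1 : t < 1) {n : ℕ} (hn : 0 < n) :
    ENNReal.ofReal (1 / ((n : ℝ) - t)) =
      ∑' k : ℕ, ENNReal.ofReal t ^ k * ENNReal.ofReal (1 / (n : ℝ) ^ (k + 1)) := by
  have h := hasSum_one_div_sub h0 h1 hn
  rw [← h.tsum_eq, ENNReal.ofReal_tsum_of_nonneg (fun k => by positivity) h.summable]
  exact tsum_congr fun k => by rw [ENNReal.ofReal_mul (by positivity), ENNReal.ofReal_pow h0]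

lemma mzvTerm_nonneg {r : ℕ} (k : Fin r → ℕ) (m : DecTuple r) : 0 ≤ mzvTerm k m :=
  prod_nonneg fun _ _ => by positivity

lemma mem_admissibleIndices {b w : ℕ} {k : Fin (b + 1) → ℕ} :
    k ∈ admissibleIndices b w ↔ ∑ i, k i = w ∧ 2 ≤ k 0 ∧ ∀ j, 1 ≤ k j := by
  simp [admissibleIndices, Nat.mem_antidiagonalTuple]

lemma sum_one_add_single (b : ℕ) :
    ∑ i : Fin (b + 1), (1 + Pi.single (M := fun _ => ℕ) 0 1 : Fin (b + 1) → ℕ) i = b + 2 := by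
  simp [sum_add_distrib, add_assoc]

lemma sum_admissibleIndices {M : Type*} [AddCommMonoid M] (a b : ℕ) (f : (Fin (b + 1) → ℕ) → M) :
    ∑ k ∈ admissibleIndices b (a + b + 2), f k =
      ∑ e ∈ Nat.antidiagonalTuple (b + 1) a, f (e + (1 + Pi.single 0 1)) := by
  refine (sum_bij (fun e _ => e + (1 + Pi.single 0 1)) (fun e he => ?_)
    (fun _ _ _ _ h => add_right_cancel h) (fun k hk => ?_) fun _ _ => rfl).symm
  · rw [Nat.mem_antidiagonalTuple] at he
    refine mem_admissibleIndices.2 ⟨?_, ?_, fun j => ?_⟩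
    · simp_rw [Pi.add_apply e, sum_add_distrib, he, sum_one_add_single]
      ring
    · simp
    · simp only [Pi.add_apply, Pi.one_apply]
      omega
  · obtain ⟨hs, h0, hk⟩ := mem_admissibleIndices.1 hk
    have hle : 1 + Pi.single 0 1 ≤ k := by
      intro j
      rcases eq_or_ne j 0 with rfl | hj
      · simpa using h0
      · simpa [hj] using hk j
    refine ⟨k - (1 + Pi.single 0 1), ?_, tsub_add_cancel_of_le hle⟩
    rw [Nat.mem_antidiagonalTuple]
    have h := hs
    rw [← tsub_add_cancel_of_le hle] at h
    simp_rw [Pi.add_apply (k - _), sum_add_distrib, sum_one_add_single] at h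
    omega

/-- Geometric expansion of every factor, grouped by total degree; the extra `1 / m 0` forces the
first exponent to be at least `2`. -/
lemma tsum_prod_one_div_sub_eq {t : ℝ} (h0 : 0 ≤ t) (h1 : t < 1) (b : ℕ) :
    ∑' m : DecTuple (b + 1),
        ENNReal.ofReal ((∏ i, 1 / ((m.1 i : ℝ) - t)) * (1 / (m.1 0 : ℝ))) =
      ∑' a : ℕ, ENNReal.ofReal t ^ a * ∑ k ∈ admissibleIndices b (a + b + 2),
        ∑' m : DecTuple (b + 1), ENNReal.ofReal (mzvTerm k m) := by
  have hm : ∀ m : DecTuple (b + 1),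
      ENNReal.ofReal ((∏ i, 1 / ((m.1 i : ℝ) - t)) * (1 / (m.1 0 : ℝ))) =
        ∑' e : Fin (b + 1) → ℕ, ENNReal.ofReal t ^ (∑ i, e i) *
          ENNReal.ofReal (mzvTerm (e + (1 + Pi.single 0 1)) m) := fun m => by
    rw [ENNReal.ofReal_mul (prod_one_div_sub_pos h1 m).le,
      ENNReal.ofReal_prod_of_nonneg fun i _ => (one_div_sub_pos h1 (m.2.2 i)).le]
    simp_rw [ofReal_one_div_sub h0 h1 (m.2.2 _)]
    rw [prod_tsum_eq_tsum_prod, ← ENNReal.tsum_mul_right]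
    refine tsum_congr fun e => ?_
    rw [prod_mul_distrib, prod_pow_eq_pow_sum, mul_assoc,
      ← ENNReal.ofReal_prod_of_nonneg fun i _ => by positivity,
      ← ENNReal.ofReal_mul (prod_nonneg fun i _ => by positivity)]
    congr 2
    rw [mzvTerm, Fin.prod_univ_succ, Fin.prod_univ_succ]
    simp [pow_succ]
    ring
  simp_rw [hm]
  rw [ENNReal.tsum_comm, ← (Nat.sigmaAntidiagonalTupleEquivTuple (b + 1)).tsum_eq,
    ENNReal.tsum_sigma']
  refine tsum_congr fun a => ?_
  rw [sum_admissibleIndices, mul_sum, tsum_fintype,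
    ← sum_coe_sort (Nat.antidiagonalTuple (b + 1) a)]
  refine Fintype.sum_congr _ _ fun e => ?_
  rw [ENNReal.tsum_mul_left]
  congr 2
  exact Nat.mem_antidiagonalTuple.1 e.2

lemma tsum_one_div_pow_mul_one_div_sub {t : ℝ} (h0 : 0 ≤ t) (h1 : t < 1) (b : ℕ) :
    ∑' n : ℕ, ENNReal.ofReal (1 / ((n + 1 : ℕ) : ℝ) ^ (b + 1) * (1 / (((n + 1 : ℕ) : ℝ) - t))) =
      ∑' a : ℕ, ENNReal.ofReal t ^ a *
        ∑' n : ℕ, ENNReal.ofReal (1 / ((n + 1 : ℕ) : ℝ) ^ (a + b + 2)) := by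
  simp_rw [← ENNReal.tsum_mul_left]
  rw [ENNReal.tsum_comm]
  refine tsum_congr fun n => ?_
  rw [ENNReal.ofReal_mul (by positivity), ofReal_one_div_sub h0 h1 n.succ_pos,
    ← ENNReal.tsum_mul_left]
  refine tsum_congr fun a => ?_
  rw [mul_left_comm, ← ENNReal.ofReal_mul (by positivity)]
  congr 2
  rw [show a + b + 2 = b + 1 + (a + 1) by ring, pow_add _ (b + 1) (a + 1)]
  field_simp

lemma tsum_one_div_pow_mul_one_div_sub_half_ne_top (b : ℕ) :
    ∑' n : ℕ, ENNReal.ofReal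
      (1 / ((n + 1 : ℕ) : ℝ) ^ (b + 1) * (1 / (((n + 1 : ℕ) : ℝ) - 1 / 2))) ≠ ∞ := by
  have hs : Summable fun n : ℕ => 2 * (1 / ((n + 1 : ℕ) : ℝ) ^ 2) :=
    ((summable_nat_add_iff 1).2 (Real.summable_one_div_nat_pow.2 one_lt_two)).mul_left 2
  refine ne_top_of_le_ne_top hs.tsum_ofReal_ne_top (ENNReal.tsum_le_tsum fun n =>
    ENNReal.ofReal_le_ofReal ?_)
  have hn : (1 : ℝ) ≤ ((n + 1 : ℕ) : ℝ) := by exact_mod_cast n.succ_pos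
  generalize ((n + 1 : ℕ) : ℝ) = x at hn
  calc 1 / x ^ (b + 1) * (1 / (x - 1 / 2)) ≤ 1 / x * (1 / (x / 2)) := by
        gcongr
        · exact one_div_nonneg.2 (by linarith)
        · exact le_self_pow₀ hn (by omega)
        · linarith
    _ = 2 * (1 / x ^ 2) := by field_simp

/-- The sum formula for multiple zeta values, in `ℝ≥0∞`. -/
lemma sum_tsum_mzvTerm (a b : ℕ) :
    ∑ k ∈ admissibleIndices b (a + b + 2),
        ∑' m : DecTuple (b + 1), ENNReal.ofReal (mzvTerm k m) =
      ∑' n : ℕ, ENNReal.ofReal (1 / ((n + 1 : ℕ) : ℝ) ^ (a + b + 2)) ∧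
    ∑' n : ℕ, ENNReal.ofReal (1 / ((n + 1 : ℕ) : ℝ) ^ (a + b + 2)) ≠ ∞ := by
  refine eq_of_tsum_pow_mul_eq
    (A := fun a => ∑ k ∈ admissibleIndices b (a + b + 2),
      ∑' m : DecTuple (b + 1), ENNReal.ofReal (mzvTerm k m))
    (B := fun a => ∑' n : ℕ, ENNReal.ofReal (1 / ((n + 1 : ℕ) : ℝ) ^ (a + b + 2)))
    ?_ (fun x _ hx => ?_) a
  · have h2 : (2⁻¹ : ℝ≥0∞) = ENNReal.ofReal (1 / 2) := by
      rw [one_div, ENNReal.ofReal_inv_of_pos two_pos, ENNReal.ofReal_ofNat]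
    rw [h2, ← tsum_one_div_pow_mul_one_div_sub (by norm_num) (by norm_num)]
    exact tsum_one_div_pow_mul_one_div_sub_half_ne_top b
  · have hx1 : x < 1 := hx.trans_lt (by simp)
    have ht : x.toReal < 1 := by
      simpa using (ENNReal.toReal_lt_toReal hx1.ne_top ENNReal.one_ne_top).2 hx1
    have h := tsum_prod_one_div_sub ht b
    rwa [tsum_prod_one_div_sub_eq ENNReal.toReal_nonneg ht,
      tsum_one_div_pow_mul_one_div_sub ENNReal.toReal_nonneg ht,
      ENNReal.ofReal_toReal hx1.ne_top] at h

/-! ### Convergence and the passage to real series -/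

lemma tsum_ofReal_mzvTerm_ne_top {a b : ℕ} {k : Fin (b + 1) → ℕ}
    (hk : k ∈ admissibleIndices b (a + b + 2)) :
    ∑' m : DecTuple (b + 1), ENNReal.ofReal (mzvTerm k m) ≠ ∞ := by
  obtain ⟨h, hfin⟩ := sum_tsum_mzvTerm a b
  rw [← h] at hfin
  exact (ENNReal.sum_ne_top.1 hfin) k hk

lemma summable_of_tsum_ofReal_ne_top {ι : Type*} {f : ι → ℝ} (hf : ∀ i, 0 ≤ f i)
    (h : ∑' i, ENNReal.ofReal (f i) ≠ ∞) : Summable f := by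
  simpa [ENNReal.toReal_ofReal (hf _)] using ENNReal.summable_toReal h

lemma toReal_tsum_ofReal {ι : Type*} {f : ι → ℝ} (hf : ∀ i, 0 ≤ f i) :
    (∑' i, ENNReal.ofReal (f i)).toReal = ∑' i, f i := by
  rw [ENNReal.tsum_toReal_eq fun _ => ENNReal.ofReal_ne_top]
  simp [ENNReal.toReal_ofReal (hf _)]

lemma summable_mzvTerm {a b : ℕ} {k : Fin (b + 1) → ℕ}
    (hk : k ∈ admissibleIndices b (a + b + 2)) : Summable (mzvTerm k) :=
  summable_of_tsum_ofReal_ne_top (mzvTerm_nonneg k) (tsum_ofReal_mzvTerm_ne_top hk)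

lemma sum_mzv (a b : ℕ) :
    riemannZeta ((a + b + 2 : ℕ) : ℂ) =
      ((∑ k ∈ admissibleIndices b (a + b + 2), mzv k : ℝ) : ℂ) := by
  have hsum : Summable fun n : ℕ => 1 / (n : ℝ) ^ (a + b + 2) :=
    Real.summable_one_div_nat_pow.2 (by omega)
  have h := congrArg ENNReal.toReal (sum_tsum_mzvTerm a b).1
  rw [ENNReal.toReal_sum fun k hk => tsum_ofReal_mzvTerm_ne_top hk,
    toReal_tsum_ofReal fun n => by positivity] at h
  simp_rw [toReal_tsum_ofReal (mzvTerm_nonneg _)] at h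
  rw [zeta_nat_eq_tsum_of_gt_one (by omega)]
  unfold mzv
  rw [h]
  -- The term `n = 0` is `1 / 0 = 0`, so the shift of the index is harmless.
  have hz := hsum.tsum_eq_zero_add
  simp only [Nat.cast_zero, zero_pow (show a + b + 2 ≠ 0 by omega), div_zero, zero_add] at hz
  rw [← hz]
  push_cast
  rfl

lemma summable_mzvTerm_of_le {b : ℕ} {k : Fin (b + 1) → ℕ} (h0 : 2 ≤ k 0) (hk : ∀ j, 1 ≤ k j) :
    Summable (mzvTerm k) := by
  have hs : b + 2 ≤ ∑ i, k i := by
    rw [← sum_one_add_single]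
    refine sum_le_sum fun j _ => ?_
    rcases eq_or_ne j 0 with rfl | hj
    · simpa using h0
    · simpa [hj] using hk j
  exact summable_mzvTerm (a := ∑ i, k i - (b + 2)) (mem_admissibleIndices.2 ⟨by omega, h0, hk⟩)

/-- By linearity `q` may be a monomial. The factor `X (Fin.last b)` then makes the first entry of
the reversed index at least `2`. -/
lemma summable_prod_mul_aeval_Omega (b : ℕ) (q : MvPolynomial (Fin (b + 1)) ℚ) :
    Summable fun m : IncTuple (b + 1) => (∏ i, (1 : ℝ) / (m.1 i : ℝ)) *
      aeval (fun i => (1 : ℝ) / (m.1 i : ℝ)) (Omega (b + 1) (q * X (Fin.last b))) := by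
  induction q using MvPolynomial.induction_on' with
  | monomial l c =>
    simp_rw [X, monomial_mul, Omega_monomial, prod_mul_aeval_monomial]
    have hs : Summable (mzvTerm fun j : Fin (b + 1) =>
        (l + Finsupp.single (Fin.last b) 1 : Fin (b + 1) →₀ ℕ) j.rev + 1) :=
      summable_mzvTerm_of_le (by simp) (by simp)
    exact (hs.comp_injective (revEquiv (b + 1)).injective).mul_left _
  | add p q hp hq =>
    simp_rw [add_mul, map_add, mul_add]
    exact hp.add hq

lemma summable_xiTerm_endsIndex (b i c : ℕ) : Summable (xiTerm (endsIndex b i (c + 1))) := by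
  unfold xiTerm
  rw [tailProd_endsIndex, pow_succ, ← mul_assoc]
  exact summable_prod_mul_aeval_Omega b _

/-- Reversing and adding one is a bijection under which a positive last exponent becomes a first
entry of at least `2`. -/
lemma sum_lastPosExponents {M : Type*} [AddCommMonoid M] (a b : ℕ)
    (f : (Fin (b + 1) → ℕ) → M) :
    ∑ k ∈ lastPosExponents a b, f (fun j => k j.rev + 1) =
      ∑ k ∈ admissibleIndices b (a + b + 2), f k := by
  refine sum_bij (fun k _ j => k j.rev + 1) (fun k hk => ?_) (fun k _ l _ h => ?_)
    (fun k hk => ?_) fun _ _ => rfl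
  · simp only [lastPosExponents, mem_filter, mem_piAntidiag] at hk
    refine mem_admissibleIndices.2 ⟨?_, ?_, fun j => by omega⟩
    · have := Equiv.sum_comp Fin.revPerm k
      simp only [Fin.revPerm_apply] at this
      simp [sum_add_distrib, this, hk.1.1]
      ring
    · simp only [Fin.rev_zero]
      omega
  · ext j
    simpa using congrFun h j.rev
  · obtain ⟨hs, h0, hk⟩ := mem_admissibleIndices.1 hk
    refine ⟨fun j => k j.rev - 1, ?_, ?_⟩
    · simp only [lastPosExponents, mem_filter, mem_piAntidiag, Fin.rev_last]
      refine ⟨⟨?_, by simp⟩, by omega⟩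
      have h1 := Equiv.sum_comp Fin.revPerm fun j => k j - 1
      simp only [Fin.revPerm_apply] at h1
      rw [h1]
      have h2 : ∑ j, k j = ∑ j, (k j - 1) + ∑ _j : Fin (b + 1), 1 := by
        rw [← sum_add_distrib]
        exact sum_congr rfl fun j _ => (Nat.sub_add_cancel (hk j)).symm
      simp at h2
      omega
    · ext j
      simp [Nat.sub_add_cancel (hk j)]

lemma sum_xi_endsIndex (a b : ℕ) :
    ∑ i ∈ range (a + 1), (-1 : ℝ) ^ (a - i) / ((i ! : ℝ) * ((a + 1 - i)! : ℝ)) *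
        xi (endsIndex b i (a - i + 1)) =
      ∑ k ∈ admissibleIndices b (a + b + 2), mzv k := by
  have hterm : ∀ m : IncTuple (b + 1),
      ∑ i ∈ range (a + 1), (-1 : ℝ) ^ (a - i) / ((i ! : ℝ) * ((a + 1 - i)! : ℝ)) *
        xiTerm (endsIndex b i (a - i + 1)) m =
      ∑ k ∈ admissibleIndices b (a + b + 2), mzvTerm k (revEquiv (b + 1) m) := fun m => by
    have h := congrArg (fun p => (∏ i, (1 : ℝ) / (m.1 i : ℝ)) *
      aeval (fun i => (1 : ℝ) / (m.1 i : ℝ)) p) (sum_smul_Omega_tailProd a b)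
    simp only [map_sum, map_smul, mul_sum, prod_mul_aeval_monomial] at h
    rw [← sum_lastPosExponents a b fun k => mzvTerm k (revEquiv (b + 1) m)]
    refine Eq.trans (sum_congr rfl fun i _ => ?_) (h.trans (sum_congr rfl fun k _ => ?_))
    · rw [xiTerm, Algebra.smul_def, mul_left_comm]
      simp
    · simp
  unfold xi mzv
  simp_rw [← tsum_mul_left]
  rw [← Summable.tsum_finsetSum fun i _ => (summable_xiTerm_endsIndex b i (a - i)).mul_left _,
    ← Summable.tsum_finsetSum fun k hk => summable_mzvTerm hk, ← (revEquiv (b + 1)).tsum_eq]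
  exact tsum_congr hterm

end ConjMZV

theorem mainTheorem3 (a b : ℕ) :
    (∀ i ∈ Finset.range (a + 1),
      Summable (ConjMZV.xiTerm (ConjMZV.endsIndex b i (a - i + 1)))) ∧
    (∀ k ∈ ConjMZV.admissibleIndices b (a + b + 2), Summable (ConjMZV.mzvTerm k)) ∧
    ((∑ i ∈ Finset.range (a + 1),
        (-1 : ℝ) ^ (a - i) / ((i ! : ℝ) * ((a + 1 - i)! : ℝ)) *
          ConjMZV.xi (ConjMZV.endsIndex b i (a - i + 1)) : ℝ) : ℂ) =
      riemannZeta ((a + b + 2 : ℕ) : ℂ) ∧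
    riemannZeta ((a + b + 2 : ℕ) : ℂ) =
      ((∑ k ∈ ConjMZV.admissibleIndices b (a + b + 2), ConjMZV.mzv k : ℝ) : ℂ) :=
  ⟨fun i _ => ConjMZV.summable_xiTerm_endsIndex b i (a - i), fun _ hk => ConjMZV.summable_mzvTerm hk,
    by rw [ConjMZV.sum_xi_endsIndex, ConjMZV.sum_mzv], ConjMZV.sum_mzv a b⟩
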